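/- \textbf{Theorem.} Let $\lambda$ denote Lebesgue measure on $[0,1]$. A bivariate copula is a bivariate distribution function $C$ on $[0,1]^2$ with uniform univariate marginals; $\mu_C$ is the corresponding (doubly stochastic) probability measure, $\mu_C([0,x]\times[0,y])=C(x,y)$, and $K_C(x,E)$ is (a version of) the regular conditional distribution of $Y$ given $X=x$ for $(X,Y)\sim\mu_C$, which is uniquely determined for $\lambda$-almost every $x$. Set $$D_1(C,C')=\int_{[0,1]}\int_{[0,1]}\big|K_C(x,[0,y])-K_{C'}(x,[0,y])\big|\,\mathrm d\lambda(x)\,\mathrm d\lambda(y).$$ A Pickands dependence function is a convex function $A:[0,1]\to[0,1]$ with $A(0)=A(1)=1$ and $\max(1-x,x)\le A(x)\le 1$ for all $x\in[0,1]$; a copula $C$ is an Extreme Value copula with Pickands dependence function $A$ if $$C(x,y)=(xy)^{A\left(\frac{\ln x}{\ln (xy)}\right)}\qquad\text{for all }x,y\in(0,1).$$ Let $D^+A$ be the right-hand derivative of $A$ on $[0,1)$, with $D^+A(1)$ the left-hand derivative of $A$ at $1$, and let $\mathrm{Cont}(D^+A)$ be the set of continuity points of $D^+A$ in $(0,1)$.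 Let $C,C_1,C_2,\ldots$ be Extreme Value copulas with Pickands dependence functions $A,A_1,A_2,\ldots$, respectively. Then the following assertions are equivalent: \begin{enumerate} \item[(a)] $\lim_{n\to\infty}C_n(x,y)=C(x,y)$ for all $x,y\in[0,1]$; \item[(b)] $\lim_{n\to\infty}A_n(x)=A(x)$ for all $x\in[0,1]$; \item[(c)] $\lim_{n\to\infty}D^+A_n(x)=D^+A(x)$ for all $x\in\mathrm{Cont}(D^+A)$; \item[(d)] $\lim_{n\to\infty}D_1(C_n,C)=0$; \item[(e)] $(C_n)_{n\in\mathbb N}$ converges weakly conditional to $C$: for $\lambda$-almost every $x\in[0,1]$ the probability measures $K_{C_n}(x,\cdot)$ converge weakly to $K_C(x,\cdot)$ as $n\to\infty$. \end{enumerate} -/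

import Mathlib

open MeasureTheory ProbabilityTheory Filter Topology Set unitInterval

noncomputable section

/-- A bivariate copula: a bivariate distribution function on the unit square `[0,1]²` both of whose
univariate marginals are the uniform distribution (`volume` on `I = [0,1]` is Lebesgue measure). -/
structure Copula where
  toFun : I → I → ℝ
  exists_measure : ∃ μ : Measure (I × I), μ.fst = volume ∧ μ.snd = volume ∧
    ∀ x y : I, μ.real (Iic x ×ˢ Iic y) = toFun x y

namespace Copula

instance : CoeFun Copula (fun _ => I → I → ℝ) := ⟨Copula.toFun⟩

/-- The doubly stochastic measure `μ_C` of a copula `C`: `μ_C ([0,x] × [0,y]) = C(x,y)`. -/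
def measure (C : Copula) : Measure (I × I) := C.exists_measure.choose

theorem measure_fst (C : Copula) : C.measure.fst = volume := C.exists_measure.choose_spec.1

theorem measure_snd (C : Copula) : C.measure.snd = volume := C.exists_measure.choose_spec.2.1

theorem measure_real_Iic (C : Copula) (x y : I) : C.measure.real (Iic x ×ˢ Iic y) = C x y :=
  C.exists_measure.choose_spec.2.2 x y

instance (C : Copula) : IsProbabilityMeasure C.measure := by
  refine ⟨?_⟩
  rw [← Measure.fst_univ, C.measure_fst]
  exact measure_univ

/-- The measure of a copula is determined by the copula. -/
theorem eq_measure (C : Copula) {μ : Measure (I × I)} (h1 : μ.fst = volume)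
    (h : ∀ x y : I, μ.real (Iic x ×ˢ Iic y) = C x y) : μ = C.measure := by
  have hμ : IsProbabilityMeasure μ := by
    refine ⟨?_⟩
    rw [← Measure.fst_univ, h1]
    exact measure_univ
  have hr : ∀ x y : I, μ (Iic x ×ˢ Iic y) = C.measure (Iic x ×ˢ Iic y) := by
    intro x y
    have := (h x y).trans (C.measure_real_Iic x y).symm
    simpa [Measure.real, ENNReal.toReal_eq_toReal_iff'] using this
  have hgen : borel I = MeasurableSpace.generateFrom (range (Iic : I → Set I)) :=
    borel_eq_generateFrom_Iic I
  have hspan : IsCountablySpanning (range (Iic : I → Set I)) :=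
    ⟨fun _ => Iic 1, fun _ => ⟨1, rfl⟩, by
      rw [iUnion_const]; exact eq_univ_of_forall fun x => x.2.2⟩
  refine ext_of_generate_finite (image2 (· ×ˢ ·) (range (Iic : I → Set I)) (range (Iic : I → Set I)))
    ?_ ?_ ?_ ?_
  · exact (generateFrom_eq_prod ((BorelSpace.measurable_eq (α := I)).trans hgen).symm
      ((BorelSpace.measurable_eq (α := I)).trans hgen).symm hspan hspan).symm
  · exact isPiSystem_Iic.prod isPiSystem_Iic
  · rintro _ ⟨_, ⟨x, rfl⟩, _, ⟨y, rfl⟩, rfl⟩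
    exact hr x y
  · simp

/-- The Markov kernel `K_C` of a copula `C`: the regular conditional distribution of `Y` given `X`
for `(X,Y) ∼ C`. -/
def kernel (C : Copula) : Kernel I I := C.measure.condKernel

instance (C : Copula) : IsMarkovKernel C.kernel := by
  unfold kernel
  infer_instance

theorem compProd_kernel (C : Copula) : (volume : Measure I) ⊗ₘ C.kernel = C.measure := by
  rw [← C.measure_fst]
  exact C.measure.disintegrate C.measure.condKernel

/-- Any two versions of the Markov kernel of a copula agree at almost every `x`, so the notions
below do not depend on the version. -/
theorem eq_kernel (C : Copula) (K : Kernel I I) [IsMarkovKernel K]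
    (hK : (volume : Measure I) ⊗ₘ K = C.measure) : ∀ᵐ x : I, K x = C.kernel x := by
  have h := eq_condKernel_of_measure_eq_compProd (ρ := C.measure) K
    (by rw [C.measure_fst]; exact hK.symm)
  rwa [C.measure_fst] at h

/-- The metric `D₁(C₁,C₂) = ∫ ∫ |K_{C₁}(x,[0,y]) - K_{C₂}(x,[0,y])| dλ(x) dλ(y)`. -/
def D1 (C₁ C₂ : Copula) : ℝ :=
  ∫ y : I, ∫ x : I, |(C₁.kernel x).real (Iic y) - (C₂.kernel x).real (Iic y)|

/-- The probability measure `K_C(x, ·)` on `[0,1]`. -/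
def condDist (C : Copula) (x : I) : ProbabilityMeasure I := ⟨C.kernel x, inferInstance⟩

/-- Weak conditional convergence: for almost every `x`, the conditional distributions
`K_{C_n}(x, ·)` converge weakly to `K_C(x, ·)`. -/
def WeakCondTendsto (C : ℕ → Copula) (C' : Copula) : Prop :=
  ∀ᵐ x : I, Tendsto (fun n => (C n).condDist x) atTop (𝓝 (C'.condDist x))

end Copula

/-- `A` (of which only the values on `[0,1]` matter) is a Pickands dependence function. -/
structure IsPickands (A : ℝ → ℝ) : Prop where
  convexOn : ConvexOn ℝ (Icc 0 1) A
  zero : A 0 = 1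
  one : A 1 = 1
  max_le : ∀ x ∈ Icc (0 : ℝ) 1, max (1 - x) x ≤ A x
  le_one : ∀ x ∈ Icc (0 : ℝ) 1, A x ≤ 1

/-- `C` is an Extreme Value copula with Pickands dependence function `A`. -/
structure Copula.IsExtremeValueWith (C : Copula) (A : ℝ → ℝ) : Prop where
  isPickands : IsPickands A
  eq_rpow : ∀ x y : I, (x : ℝ) ∈ Ioo (0 : ℝ) 1 → (y : ℝ) ∈ Ioo (0 : ℝ) 1 →
    C x y = ((x : ℝ) * y) ^ A (Real.log x / Real.log (x * y))

/-- `D⁺A` on `[0,1]`: the right-hand derivative of `A` on `[0,1)`, and the left-hand derivative of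
`A` at `1`. -/
def rightDeriv (A : ℝ → ℝ) (x : ℝ) : ℝ :=
  if x < 1 then derivWithin A (Ioi x) x else derivWithin A (Iio x) x

/-- `Cont(D⁺A)`: the continuity points of `D⁺A` in `(0,1)`. -/
def contRightDeriv (A : ℝ → ℝ) : Set ℝ :=
  {x | x ∈ Ioo (0 : ℝ) 1 ∧ ContinuousAt (rightDeriv A) x}

end

/-! The implications run (a) ⇒ (b) ⇒ (e) ⇒ (d) ⇒ (a), together with (b) ⇔ (c). With x = e^{-u}, y =
e^{-v} an Extreme Value copula is C(x,y) = exp(-P(u)), where P(u) = (u+v) A(u/(u+v)) is convex in u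
(`convexOn_perspective`). Reading A off log C gives (a) ⇒ (b).

The key principle is `HasDerivAt.tendsto_of_slope`: pointwise convergence of convex functions forces
convergence of their subgradients wherever the limit is differentiable. Applied to A it gives (b) ⇒
(c). Applied to P it gives (b) ⇒ (e): K_C(x,[0,y]) is almost everywhere the x-derivative of C, so
P'(u) = K_C(x,[0,y]) x / C(x,y), and no formula for the kernel in terms of D⁺A is needed.

For (c) ⇒ (b), A is 1 plus the integral of D⁺A and |D⁺A| ≤ 1, so dominated convergence applies; it
also gives (e) ⇒ (d). Finally (d) ⇒ (a) holds because copulas are 1-Lipschitz in y, which turns an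
integral bound into a pointwise one (`abs_sub_le_D1`). -/

/-- If functions converge pointwise near `x` to a function differentiable at `x`, then any
subgradients of them at `x` converge to the derivative of the limit. -/
theorem HasDerivAt.tendsto_of_slope {f : ℕ → ℝ → ℝ} {g : ℝ → ℝ} {c : ℕ → ℝ} {L x : ℝ} {S : Set ℝ}
    (hS : S ∈ 𝓝 x) (hfg : ∀ y ∈ S, Tendsto (fun n => f n y) atTop (𝓝 (g y)))
    (hr : ∀ n, ∀ y ∈ S, x < y → c n ≤ slope (f n) x y)
    (hl : ∀ n, ∀ y ∈ S, y < x → slope (f n) y x ≤ c n)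
    (hg : HasDerivAt g L x) : Tendsto c atTop (𝓝 L) := by
  have hx : x ∈ S := mem_of_mem_nhds hS
  have hslope : ∀ y ∈ S, Tendsto (fun n => slope (f n) x y) atTop (𝓝 (slope g x y)) := by
    intro y hy
    simp only [slope_def_field]
    exact ((hfg y hy).sub (hfg x hx)).div_const _
  obtain ⟨gl, gr⟩ := hasDerivAt_iff_tendsto_slope_left_right.1 hg
  refine tendsto_order.2 ⟨fun a ha => ?_, fun a ha => ?_⟩
  -- One left slope of `g` already exceeds `a`. The slopes of `f n` at this fixed `y` converge to it
  -- and bound `c n` from below; the upper bound is symmetric.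
  · obtain ⟨y, hy, hyS, hyx⟩ := ((gl.eventually (lt_mem_nhds ha)).and
      ((eventually_mem_set.2 (mem_nhdsWithin_of_mem_nhds hS)).and
        eventually_mem_nhdsWithin)).exists
    filter_upwards [(hslope y hyS).eventually (lt_mem_nhds hy)] with n hn
    exact hn.trans_le (slope_comm (f n) x y ▸ hl n y hyS hyx)
  · obtain ⟨y, hy, hyS, hyx⟩ := ((gr.eventually (gt_mem_nhds ha)).and
      ((eventually_mem_set.2 (mem_nhdsWithin_of_mem_nhds hS)).and
        eventually_mem_nhdsWithin)).exists
    filter_upwards [(hslope y hyS).eventually (gt_mem_nhds hy)] with n hn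
    exact (hr n y hyS hyx).trans_lt hn

/-! ### Pickands dependence functions and their one-sided derivatives. -/

namespace IsPickands

variable {A : ℝ → ℝ}

theorem rightDeriv_eq {x : ℝ} (hx : x < 1) : rightDeriv A x = derivWithin A (Ioi x) x :=
  if_pos hx

theorem rightDeriv_le_slope (hA : IsPickands A) {x y : ℝ} (hx : x ∈ Ioo (0 : ℝ) 1)
    (hy : y ∈ Icc (0 : ℝ) 1) (hxy : x < y) : rightDeriv A x ≤ slope A x y := by
  rw [rightDeriv_eq hx.2]
  exact hA.convexOn.rightDeriv_le_slope_of_mem_interior (by rwa [interior_Icc]) hy hxy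

theorem slope_le_leftDeriv (hA : IsPickands A) {x y : ℝ} (hx : x ∈ Ioo (0 : ℝ) 1)
    (hy : y ∈ Icc (0 : ℝ) 1) (hxy : y < x) : slope A y x ≤ derivWithin A (Iio x) x :=
  hA.convexOn.slope_le_leftDeriv_of_mem_interior hy (by rwa [interior_Icc]) hxy

theorem leftDeriv_le_rightDeriv (hA : IsPickands A) {x : ℝ} (hx : x ∈ Ioo (0 : ℝ) 1) :
    derivWithin A (Iio x) x ≤ rightDeriv A x := by
  rw [rightDeriv_eq hx.2]
  exact hA.convexOn.leftDeriv_le_rightDeriv_of_mem_interior (by rwa [interior_Icc])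

theorem slope_le_rightDeriv (hA : IsPickands A) {x y : ℝ} (hx : x ∈ Ioo (0 : ℝ) 1)
    (hy : y ∈ Icc (0 : ℝ) 1) (hxy : y < x) : slope A y x ≤ rightDeriv A x :=
  (hA.slope_le_leftDeriv hx hy hxy).trans (hA.leftDeriv_le_rightDeriv hx)

theorem hasDerivWithinAt_rightDeriv (hA : IsPickands A) {x : ℝ} (hx : x ∈ Ioo (0 : ℝ) 1) :
    HasDerivWithinAt A (rightDeriv A x) (Ioi x) x := by
  rw [rightDeriv_eq hx.2]
  exact hA.convexOn.hasDerivWithinAt_rightDeriv_of_mem_interior (by rwa [interior_Icc])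

theorem monotoneOn_rightDeriv (hA : IsPickands A) : MonotoneOn (rightDeriv A) (Ioo 0 1) := by
  have h := hA.convexOn.monotoneOn_rightDeriv
  rw [interior_Icc] at h
  exact h.congr fun x hx => (rightDeriv_eq hx.2).symm

/-- Compare with the chords to the endpoints: A(x) ≥ 1 - x bounds the slope from 0 below by -1, and
A(x) ≥ x bounds the slope to 1 above by 1. -/
theorem abs_rightDeriv_le_one (hA : IsPickands A) {x : ℝ} (hx : x ∈ Ioo (0 : ℝ) 1) :
    |rightDeriv A x| ≤ 1 := by
  obtain ⟨h0, h1⟩ := hx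
  have hm := max_le_iff.1 (hA.max_le x ⟨h0.le, h1.le⟩)
  refine abs_le.2 ⟨?_, ?_⟩
  · refine le_trans ?_ (hA.slope_le_rightDeriv ⟨h0, h1⟩ (left_mem_Icc.2 zero_le_one) h0)
    rw [slope_def_field, hA.zero, le_div_iff₀ (by linarith)]
    linarith
  · refine (hA.rightDeriv_le_slope ⟨h0, h1⟩ (right_mem_Icc.2 zero_le_one) h1).trans ?_
    rw [slope_def_field, hA.one, div_le_iff₀ (by linarith)]
    linarith

/-- A Pickands dependence function is differentiable where its right derivative is continuous. -/
theorem hasDerivAt_of_mem_contRightDeriv (hA : IsPickands A) {x : ℝ} (hx : x ∈ contRightDeriv A) :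
    HasDerivAt A (rightDeriv A x) x := by
  obtain ⟨hx, hc⟩ := hx
  have hleft := hA.convexOn.hasDerivWithinAt_leftDeriv_of_mem_interior
    (x := x) (by rwa [interior_Icc])
  have heq : derivWithin A (Iio x) x = rightDeriv A x := by
    refine (hA.leftDeriv_le_rightDeriv hx).antisymm ?_
    -- For y < x, D⁺A(y) is at most the slope over [y, x], hence at most the left derivative at x;
    -- now let y increase to x.
    refine le_of_tendsto (hc.tendsto.mono_left (nhdsWithin_le_nhds (s := Iio x))) ?_
    filter_upwards [Ioo_mem_nhdsLT hx.1] with y hy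
    exact (hA.rightDeriv_le_slope ⟨hy.1, hy.2.trans hx.2⟩ ⟨hx.1.le, hx.2.le⟩ hy.2).trans
      (hA.slope_le_leftDeriv hx ⟨hy.1.le, (hy.2.trans hx.2).le⟩ hy.2)
  rw [heq] at hleft
  refine hasDerivAt_iff_tendsto_slope_left_right.2 ⟨?_, ?_⟩
  · exact (hasDerivWithinAt_iff_tendsto_slope' self_notMem_Iio).1 hleft
  · exact (hasDerivWithinAt_iff_tendsto_slope' self_notMem_Ioi).1 (hA.hasDerivWithinAt_rightDeriv hx)

/-- Convexity yields continuity only in the interior; at the endpoints A is squeezed between max(1 -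
x, x) and 1. -/
theorem continuousOn (hA : IsPickands A) : ContinuousOn A (Icc 0 1) := by
  intro x hx
  rcases hx.1.eq_or_lt with rfl | h0
  · have h : ∀ y ∈ Icc (0 : ℝ) 1, 1 - y ≤ A y := fun y hy =>
      (le_max_left _ _).trans (hA.max_le y hy)
    rw [ContinuousWithinAt, hA.zero]
    refine tendsto_of_tendsto_of_tendsto_of_le_of_le' (g := fun y => 1 - y) (h := fun _ => 1)
      ?_ tendsto_const_nhds ?_ ?_
    · have : ContinuousWithinAt (fun y : ℝ => 1 - y) (Icc 0 1) 0 := by fun_prop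
      simpa [ContinuousWithinAt] using this
    · filter_upwards [self_mem_nhdsWithin] with y hy using h y hy
    · filter_upwards [self_mem_nhdsWithin] with y hy using hA.le_one y hy
  rcases hx.2.eq_or_lt with rfl | h1
  · have h : ∀ y ∈ Icc (0 : ℝ) 1, y ≤ A y := fun y hy =>
      (le_max_right _ _).trans (hA.max_le y hy)
    rw [ContinuousWithinAt, hA.one]
    refine tendsto_of_tendsto_of_tendsto_of_le_of_le' (g := fun y => y) (h := fun _ => 1)
      nhdsWithin_le_nhds tendsto_const_nhds ?_ ?_
    · filter_upwards [self_mem_nhdsWithin] with y hy using h y hy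
    · filter_upwards [self_mem_nhdsWithin] with y hy using hA.le_one y hy
  · have := hA.convexOn.continuousOn_interior
    rw [interior_Icc] at this
    exact (this.continuousAt (Ioo_mem_nhds h0 h1)).continuousWithinAt

theorem integrableOn_rightDeriv (hA : IsPickands A) : IntegrableOn (rightDeriv A) (Ioo 0 1) := by
  refine Integrable.of_bound (aemeasurable_restrict_of_monotoneOn measurableSet_Ioo
      hA.monotoneOn_rightDeriv).aestronglyMeasurable 1 ?_
  filter_upwards [ae_restrict_mem measurableSet_Ioo] with x hx
  exact hA.abs_rightDeriv_le_one hx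

theorem eq_one_add_integral (hA : IsPickands A) {x : ℝ} (hx : x ∈ Icc (0 : ℝ) 1) :
    A x = 1 + ∫ t in (0 : ℝ)..x, rightDeriv A t := by
  have hint : IntervalIntegrable (rightDeriv A) volume 0 x := by
    rw [intervalIntegrable_iff_integrableOn_Ioo_of_le hx.1]
    exact hA.integrableOn_rightDeriv.mono_set (Ioo_subset_Ioo_right hx.2)
  rw [intervalIntegral.integral_eq_sub_of_hasDeriv_right_of_le hx.1
    (hA.continuousOn.mono (Icc_subset_Icc_right hx.2))
    (fun t ht => hA.hasDerivWithinAt_rightDeriv ⟨ht.1, ht.2.trans_le hx.2⟩) hint, hA.zero]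
  ring

/-- A monotone function has only countably many discontinuities. -/
theorem ae_mem_contRightDeriv (hA : IsPickands A) :
    ∀ᵐ x : ℝ, x ∈ Ioo (0 : ℝ) 1 → x ∈ contRightDeriv A := by
  refine measure_mono_null ?_
    (hA.monotoneOn_rightDeriv.countable_not_continuousWithinAt.measure_zero volume)
  intro x hx
  simp only [mem_compl_iff, mem_ofPred_eq, Classical.not_imp] at hx
  exact ⟨hx.1, fun h => hx.2 ⟨hx.1, h.continuousAt (Ioo_mem_nhds hx.1.1 hx.1.2)⟩⟩

theorem tendsto_rightDeriv {A : ℕ → ℝ → ℝ} {A' : ℝ → ℝ} (hA : ∀ n, IsPickands (A n))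
    (hA' : IsPickands A')
    (h : ∀ x ∈ Icc (0 : ℝ) 1, Tendsto (fun n => A n x) atTop (𝓝 (A' x))) {x : ℝ}
    (hx : x ∈ contRightDeriv A') :
    Tendsto (fun n => rightDeriv (A n) x) atTop (𝓝 (rightDeriv A' x)) :=
  (hA'.hasDerivAt_of_mem_contRightDeriv hx).tendsto_of_slope (Icc_mem_nhds hx.1.1 hx.1.2) h
    (fun n _ hy hxy => (hA n).rightDeriv_le_slope hx.1 hy hxy)
    (fun n _ hy hxy => (hA n).slope_le_rightDeriv hx.1 hy hxy)

theorem tendsto_of_tendsto_rightDeriv {A : ℕ → ℝ → ℝ} {A' : ℝ → ℝ} (hA : ∀ n, IsPickands (A n))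
    (hA' : IsPickands A')
    (h : ∀ x ∈ contRightDeriv A',
      Tendsto (fun n => rightDeriv (A n) x) atTop (𝓝 (rightDeriv A' x)))
    {x : ℝ} (hx : x ∈ Icc (0 : ℝ) 1) : Tendsto (fun n => A n x) atTop (𝓝 (A' x)) := by
  rw [hA'.eq_one_add_integral hx]
  simp_rw [fun n => (hA n).eq_one_add_integral hx]
  refine tendsto_const_nhds.add ?_
  -- When x = 1 the integration range contains 1, where the interior facts about D⁺A do not apply.
  have hne : ∀ᵐ t : ℝ, t ≠ 1 := by simp [ae_iff]
  have hIoo : ∀ᵐ t : ℝ, t ∈ uIoc 0 x → t ∈ Ioo (0 : ℝ) 1 := by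
    filter_upwards [hne] with t ht htx
    rw [uIoc_of_le hx.1] at htx
    exact ⟨htx.1, (htx.2.trans hx.2).lt_of_ne ht⟩
  refine intervalIntegral.tendsto_integral_filter_of_dominated_convergence (fun _ => 1) ?_ ?_
    (by simp) ?_
  · refine Eventually.of_forall fun n => ?_
    rw [uIoc_of_le hx.1]
    refine AEStronglyMeasurable.mono_set (Ioc_subset_Ioc_right hx.2) ?_
    rw [Measure.restrict_congr_set Ioo_ae_eq_Ioc.symm]
    exact (hA n).integrableOn_rightDeriv.aestronglyMeasurable
  · refine Eventually.of_forall fun n => ?_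
    filter_upwards [hIoo] with t ht htx using (hA n).abs_rightDeriv_le_one (ht htx)
  · filter_upwards [hIoo, hA'.ae_mem_contRightDeriv] with t ht hc htx using h t (hc (ht htx))

/-- The perspective `u ↦ (u + v) A(u / (u + v))` of a Pickands dependence function is convex. -/
theorem convexOn_perspective (hA : IsPickands A) {v : ℝ} (hv : 0 < v) :
    ConvexOn ℝ (Ioi 0) fun u => (u + v) * A (u / (u + v)) := by
  refine ⟨convex_Ioi 0, fun p hp q hq a b ha hb hab => ?_⟩
  simp only [mem_Ioi, smul_eq_mul] at hp hq ⊢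
  have hmem : ∀ u : ℝ, 0 < u → u / (u + v) ∈ Icc (0 : ℝ) 1 := fun u hu =>
    ⟨by positivity, (div_le_one (by positivity)).2 (by linarith)⟩
  have hS : 0 < a * (p + v) + b * (q + v) := by
    have : min p q + v ≤ a * (p + v) + b * (q + v) := by
      calc min p q + v = a * (min p q + v) + b * (min p q + v) := by rw [← add_mul, hab, one_mul]
        _ ≤ _ := by gcongr; exacts [min_le_left _ _, min_le_right _ _]
    exact (add_pos (lt_min hp hq) hv).trans_le this
  have hsum : a * p + b * q + v = a * (p + v) + b * (q + v) := by linear_combination (-v) * hab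
  set s := a * (p + v) + b * (q + v)
  -- Since `s` = ap + bq + v, these weights sum to 1 and mix p/(p+v) and q/(q+v) into (ap + bq)/s.
  have key := hA.convexOn.2 (hmem p hp) (hmem q hq) 
    (show 0 ≤ a * (p + v) / s by positivity) (show 0 ≤ b * (q + v) / s by positivity) (by rw [← add_div]; exact div_self hS.ne')
  simp only [smul_eq_mul] at key
  have harg : a * (p + v) / s * (p / (p + v)) + b * (q + v) / s * (q / (q + v))
      = (a * p + b * q) / s := by
    have : p + v ≠ 0 := by positivity
    have : q + v ≠ 0 := by positivity
    field_simp
  rw [harg] at key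
  rw [hsum]
  calc s * A ((a * p + b * q) / s)
      ≤ s * (a * (p + v) / s * A (p / (p + v)) + b * (q + v) / s * A (q / (q + v))) := by gcongr
    _ = _ := by field_simp

end IsPickands

/-! ### Weak convergence on the unit interval from countably many points. -/

/-- Pointwise convergence of distribution functions at all rational points implies weak
convergence of probability measures on the unit interval. -/
theorem MeasureTheory.ProbabilityMeasure.tendsto_of_tendsto_cdf_rat {μ : ℕ → ProbabilityMeasure I}
    {ν : ProbabilityMeasure I}
    (h : ∀ q : ℚ, Tendsto (fun n => (μ n : Measure I).real {z : I | (z : ℝ) ≤ q}) atTop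
      (𝓝 ((ν : Measure I).real {z : I | (z : ℝ) ≤ q}))) :
    Tendsto μ atTop (𝓝 ν) := by
  have hmeas : ∀ q : ℚ, MeasurableSet {z : I | (z : ℝ) ≤ q} := fun q =>
    measurableSet_le measurable_subtype_coe measurable_const
  -- The half-open intervals (a, b] with rational endpoints: a π-system containing arbitrarily small
  -- neighbourhoods of every point.
  let S : Set (Set I) :=
    range fun p : ℚ × ℚ => {z : I | (z : ℝ) ≤ p.2} \ {z : I | (z : ℝ) ≤ p.1}
  have hS : IsPiSystem S := by
    rintro _ ⟨p, rfl⟩ _ ⟨q, rfl⟩ -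
    refine ⟨(max p.1 q.1, min p.2 q.2), ?_⟩
    ext z
    simp only [Set.mem_sdiff, mem_ofPred_eq, mem_inter_iff, Rat.cast_max, Rat.cast_min, le_min_iff,
      le_max_iff, not_or]
    tauto
  refine hS.tendsto_probabilityMeasure_of_tendsto_of_mem ?_ ?_ ?_
  · rintro _ ⟨p, rfl⟩
    exact (hmeas _).diff (hmeas _)
  · intro u hu x hx
    obtain ⟨ε, hε, hball⟩ := Metric.isOpen_iff.1 hu x hx
    obtain ⟨a, ha, hax⟩ := exists_rat_btwn (sub_lt_self (x : ℝ) hε)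
    obtain ⟨b, hxb, hb⟩ := exists_rat_btwn (lt_add_of_pos_right (x : ℝ) hε)
    refine ⟨_, ⟨(a, b), rfl⟩, ?_, fun z hz => hball ?_⟩
    · have : ∀ᶠ z : I in 𝓝 x, (z : ℝ) ∈ Ioo (a : ℝ) b :=
        continuous_subtype_val.continuousAt.eventually_mem (Ioo_mem_nhds hax hxb)
      filter_upwards [this] with z hz using ⟨hz.2.le, not_le.2 hz.1⟩
    · obtain ⟨hz1, hz2⟩ := hz
      simp only [mem_ofPred_eq, not_le] at hz1 hz2
      rw [Metric.mem_ball, Subtype.dist_eq, Real.dist_eq, abs_lt]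
      constructor <;> linarith
  · rintro _ ⟨⟨a, b⟩, rfl⟩
    -- The `min` keeps the formula valid for a > b, when the interval is empty.
    have key : ∀ κ : ProbabilityMeasure I,
        (κ : Measure I).real ({z : I | (z : ℝ) ≤ b} \ {z : I | (z : ℝ) ≤ a})
          = (κ : Measure I).real {z : I | (z : ℝ) ≤ b}
            - (κ : Measure I).real {z : I | (z : ℝ) ≤ ((min a b : ℚ) : ℝ)} := by
      intro κ
      rw [← measureReal_sdiff (fun z hz => ?_) (hmeas _)]
      · congr 1
        ext z
        simp only [Set.mem_sdiff, mem_ofPred_eq, Rat.cast_min, le_min_iff]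
        tauto
      · simp only [mem_ofPred_eq, Rat.cast_min, le_min_iff] at hz ⊢
        exact hz.2
    have := (h b).sub (h (min a b))
    simp only [← key] at this
    rw [← NNReal.tendsto_coe]
    exact this

/-! ### Markov kernels of copulas and the metric `D1`. -/

namespace Copula

theorem measurable_kernel_Iic (C : Copula) (y : I) :
    Measurable fun x => (C.kernel x).real (Iic y) :=
  (C.kernel.measurable_coe measurableSet_Iic).ennreal_toReal

theorem measurable_uncurry_kernel_Iic (C : Copula) :
    Measurable fun p : I × I => (C.kernel p.2).real (Iic p.1) := by
  have h : MeasurableSet {q : (I × I) × I | q.2 ≤ q.1.1} :=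
    measurableSet_le measurable_snd measurable_fst.fst
  exact (Kernel.measurable_kernel_prodMk_left
    (κ := C.kernel.prodMkLeft I) h).ennreal_toReal

theorem kernel_Iic_nonneg (C : Copula) (x y : I) : 0 ≤ (C.kernel x).real (Iic y) :=
  measureReal_nonneg

theorem kernel_Iic_le_one (C : Copula) (x y : I) : (C.kernel x).real (Iic y) ≤ 1 :=
  measureReal_le_one

theorem integrable_kernel_Iic (C : Copula) (y : I) :
    Integrable fun x => (C.kernel x).real (Iic y) :=
  Integrable.of_bound (C.measurable_kernel_Iic y).aestronglyMeasurable 1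
    (ae_of_all _ fun x => by
      rw [Real.norm_of_nonneg (C.kernel_Iic_nonneg x y)]; exact C.kernel_Iic_le_one x y)

theorem abs_kernel_sub_le_one (C C' : Copula) (x y : I) :
    |(C.kernel x).real (Iic y) - (C'.kernel x).real (Iic y)| ≤ 1 := by
  rw [abs_le]
  constructor <;> linarith [C.kernel_Iic_nonneg x y, C'.kernel_Iic_nonneg x y,
    C.kernel_Iic_le_one x y, C'.kernel_Iic_le_one x y]

/-- A copula is recovered from its Markov kernel by integration. -/
theorem eq_setIntegral_kernel (C : Copula) (x y : I) :
    C x y = ∫ s in Iic x, (C.kernel s).real (Iic y) := by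
  rw [← C.measure_real_Iic, Measure.real, ← C.compProd_kernel,
    Measure.compProd_apply_prod measurableSet_Iic measurableSet_Iic]
  exact (integral_toReal (C.kernel.measurable_coe measurableSet_Iic).aemeasurable
    (ae_of_all _ fun s => measure_lt_top _ _)).symm

theorem measure_prod_univ_left (C : Copula) {s : Set I} (hs : MeasurableSet s) :
    C.measure (univ ×ˢ s) = volume s := by
  rw [← C.measure_snd, Measure.snd_apply hs, univ_prod]

/-- The conditional distributions of a copula almost surely do not charge a given point. -/
theorem ae_kernel_singleton (C : Copula) (y : I) : ∀ᵐ x : I, C.kernel x {y} = 0 := by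
  have h := C.measure_prod_univ_left (measurableSet_singleton y)
  rw [← C.compProd_kernel, Measure.compProd_apply_prod MeasurableSet.univ
    (measurableSet_singleton y), measure_singleton, setLIntegral_univ,
    lintegral_eq_zero_iff (C.kernel.measurable_coe (measurableSet_singleton y))] at h
  exact h

theorem mono_right (C : Copula) (x : I) {y z : I} (h : y ≤ z) : C x y ≤ C x z := by
  rw [← C.measure_real_Iic, ← C.measure_real_Iic]
  exact measureReal_mono (prod_mono_right (Iic_subset_Iic.2 h))

/-- The added mass lies in the strip [0,1] × (y, z], which has mass z - y by uniformity of the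
second marginal. -/
theorem sub_le_sub_right (C : Copula) (x : I) {y z : I} (h : y ≤ z) :
    C x z - C x y ≤ z - y := by
  rw [← C.measure_real_Iic, ← C.measure_real_Iic, sub_le_iff_le_add']
  have hsub : Iic x ×ˢ Iic z ⊆ Iic x ×ˢ Iic y ∪ univ ×ˢ Ioc y z := by
    rintro ⟨a, b⟩ ⟨ha, hb⟩
    rcases le_or_gt b y with hby | hby
    · exact Or.inl ⟨ha, hby⟩
    · exact Or.inr ⟨trivial, hby, hb⟩
  refine (measureReal_mono hsub).trans ((measureReal_union_le _ _).trans ?_)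
  gcongr
  rw [Measure.real, C.measure_prod_univ_left measurableSet_Ioc, unitInterval.volume_Ioc,
    ENNReal.toReal_ofReal (sub_nonneg.2 (Subtype.coe_le_coe.2 h))]

theorem abs_sub_le_right (C : Copula) (x y z : I) : |C x y - C x z| ≤ |(y : ℝ) - z| := by
  rcases le_total y z with h | h
  · rw [abs_sub_comm, abs_sub_comm (y : ℝ), abs_of_nonneg (sub_nonneg.2 (C.mono_right x h)),
      abs_of_nonneg (sub_nonneg.2 (Subtype.coe_le_coe.2 h))]
    exact C.sub_le_sub_right x h
  · rw [abs_of_nonneg (sub_nonneg.2 (C.mono_right x h)), abs_of_nonneg (sub_nonneg.2 (Subtype.coe_le_coe.2 h))]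
    exact C.sub_le_sub_right x h

theorem measurable_integral_abs_kernel_sub (C C' : Copula) :
    StronglyMeasurable fun y : I =>
      ∫ x : I, |(C.kernel x).real (Iic y) - (C'.kernel x).real (Iic y)| := by
  refine StronglyMeasurable.integral_prod_right
    (f := fun y x : I => |(C.kernel x).real (Iic y) - (C'.kernel x).real (Iic y)|) ?_
  exact (measurable_abs.comp (C.measurable_uncurry_kernel_Iic.sub
    C'.measurable_uncurry_kernel_Iic)).stronglyMeasurable

theorem norm_integral_abs_kernel_sub_le (C C' : Copula) (y : I) :
    ‖∫ x : I, |(C.kernel x).real (Iic y) - (C'.kernel x).real (Iic y)|‖ ≤ 1 := by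
  refine (norm_integral_le_of_norm_le_const (C := 1) (ae_of_all _ fun x => ?_)).trans (by simp)
  rw [Real.norm_eq_abs, abs_abs]
  exact C.abs_kernel_sub_le_one C' x y

theorem integrable_integral_abs_kernel_sub (C C' : Copula) :
    Integrable fun y : I =>
      ∫ x : I, |(C.kernel x).real (Iic y) - (C'.kernel x).real (Iic y)| :=
  Integrable.of_bound (C.measurable_integral_abs_kernel_sub C').aestronglyMeasurable 1
    (ae_of_all _ (C.norm_integral_abs_kernel_sub_le C'))

theorem abs_sub_le_integral_abs_kernel_sub (C C' : Copula) (x y : I) :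
    |C x y - C' x y| ≤ ∫ s : I, |(C.kernel s).real (Iic y) - (C'.kernel s).real (Iic y)| := by
  have hi := (C.integrable_kernel_Iic y).sub (C'.integrable_kernel_Iic y)
  rw [C.eq_setIntegral_kernel, C'.eq_setIntegral_kernel,
    ← integral_sub (C.integrable_kernel_Iic y).integrableOn
      (C'.integrable_kernel_Iic y).integrableOn]
  refine abs_integral_le_integral_abs.trans ?_
  exact setIntegral_le_integral hi.abs (ae_of_all _ fun s => abs_nonneg _)

/-- The metric `D₁` controls the pointwise distance of copulas. -/
theorem abs_sub_le_D1 (C C' : Copula) (x y : I) {δ : ℝ} (h0 : 0 < δ) (h1 : δ ≤ 1) :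
    |C x y - C' x y| ≤ 2 * δ + D1 C C' / δ := by
  have hy0 : (0 : ℝ) ≤ y * (1 - δ) := mul_nonneg y.2.1 (by linarith)
  have hy1 : (y : ℝ) * (1 - δ) + δ ≤ 1 := by nlinarith [y.2.2]
  -- [a, b] = (1 - δ)y + δ[0,1] has length δ, contains y and stays inside [0,1] wherever y lies.
  -- Moving y within it costs at most δ for each copula, hence 2δ.
  let a : I := ⟨y * (1 - δ), hy0, by linarith⟩
  let b : I := ⟨y * (1 - δ) + δ, by linarith, hy1⟩
  have hvol : volume.real (Icc a b) = δ := by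
    rw [Measure.real, unitInterval.volume_Icc]
    simp [a, b, h0.le]
  have hbd : ∀ z ∈ Icc a b, |C x y - C' x y| - 2 * δ ≤
      ∫ s : I, |(C.kernel s).real (Iic z) - (C'.kernel s).real (Iic z)| := by
    intro z hz
    have hz1 : (y : ℝ) * (1 - δ) ≤ z := hz.1
    have hz2 : (z : ℝ) ≤ y * (1 - δ) + δ := hz.2
    have hyz : |(y : ℝ) - z| ≤ δ := by
      rw [abs_le]
      constructor <;> nlinarith [y.2.1, y.2.2]
    have e1 := (C.abs_sub_le_right x y z).trans hyz
    have e2 := (C'.abs_sub_le_right x y z).trans hyz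
    have e3 := C.abs_sub_le_integral_abs_kernel_sub C' x z
    have e4 : |C x y - C' x y| ≤ |C x y - C x z| + |C x z - C' x z| + |C' x y - C' x z| := by
      rw [show C x y - C' x y = (C x y - C x z) + (C x z - C' x z) - (C' x y - C' x z) by ring]
      exact (abs_sub _ _).trans (by gcongr; exact abs_add_le _ _)
    linarith
  have hint := C.integrable_integral_abs_kernel_sub C'
  have h2 : (|C x y - C' x y| - 2 * δ) * δ ≤ D1 C C' := by
    calc (|C x y - C' x y| - 2 * δ) * δ
        = ∫ _ in Icc a b, (|C x y - C' x y| - 2 * δ) := by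
          rw [setIntegral_const, hvol, smul_eq_mul, mul_comm]
      _ ≤ ∫ z in Icc a b, ∫ s : I, |(C.kernel s).real (Iic z) - (C'.kernel s).real (Iic z)| :=
          setIntegral_mono_on (integrable_const _).integrableOn hint.integrableOn
            measurableSet_Icc hbd
      _ ≤ D1 C C' := setIntegral_le_integral hint
          (ae_of_all _ fun z => integral_nonneg fun s => abs_nonneg _)
  rw [← sub_le_iff_le_add', le_div_iff₀ h0]
  exact h2

theorem tendsto_of_tendsto_D1 {C : ℕ → Copula} {C' : Copula}
    (h : Tendsto (fun n => D1 (C n) C') atTop (𝓝 0)) (x y : I) :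
    Tendsto (fun n => C n x y) atTop (𝓝 (C' x y)) := by
  rw [tendsto_iff_dist_tendsto_zero]
  refine tendsto_order.2 ⟨fun a ha => Eventually.of_forall fun n => ha.trans_le dist_nonneg,
    fun ε hε => ?_⟩
  -- This δ makes 2δ ≤ ε/2, and the `min` respects the constraint δ ≤ 1.
  have hδ : 0 < min 1 (ε / 4) := lt_min one_pos (by linarith)
  have hlim : Tendsto (fun n => 2 * min 1 (ε / 4) + D1 (C n) C' / min 1 (ε / 4)) atTop
      (𝓝 (2 * min 1 (ε / 4) + 0 / min 1 (ε / 4))) :=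
    tendsto_const_nhds.add (h.div_const _)
  rw [zero_div, add_zero] at hlim
  filter_upwards [hlim.eventually (gt_mem_nhds (show _ < ε by linarith [min_le_right 1 (ε / 4)]))]
    with n hn
  exact ((C n).abs_sub_le_D1 C' x y hδ (min_le_left _ _)).trans_lt hn

/-- Weak conditional convergence implies convergence with respect to `D₁`. -/
theorem WeakCondTendsto.tendsto_D1 {C : ℕ → Copula} {C' : Copula} (h : WeakCondTendsto C C') :
    Tendsto (fun n => D1 (C n) C') atTop (𝓝 0) := by
  have inner : ∀ y : I, Tendsto (fun n => ∫ x : I,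
      |((C n).kernel x).real (Iic y) - (C'.kernel x).real (Iic y)|) atTop (𝓝 0) := by
    intro y
    rw [← integral_zero I ℝ (μ := volume)]
    refine tendsto_integral_of_dominated_convergence (fun _ => 1) (fun n => ?_)
      (integrable_const _) (fun n => ae_of_all _ fun x => ?_) ?_
    · exact (((C n).integrable_kernel_Iic y).sub
        (C'.integrable_kernel_Iic y)).abs.aestronglyMeasurable
    · rw [Real.norm_eq_abs, abs_abs]
      exact (C n).abs_kernel_sub_le_one C' x y
    -- The limit law does not charge y, so [0,y] is a continuity set for almost every x; the null
    -- set may depend on y, which is fixed here.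
    · filter_upwards [h, C'.ae_kernel_singleton y] with x hx hxy
      have hlim := ProbabilityMeasure.tendsto_measure_of_null_frontier_of_tendsto' hx (E := Iic y)
        (measure_mono_null (frontier_Iic_subset y) hxy)
      have hlim' := (ENNReal.tendsto_toReal (measure_ne_top _ _)).comp hlim
      have := (hlim'.sub_const ((C'.kernel x).real (Iic y))).abs
      simpa [condDist, Measure.real] using this
  have := tendsto_integral_of_dominated_convergence (μ := (volume : Measure I))
    (f := fun _ => (0 : ℝ)) (fun _ => 1)
    (fun n => ((C n).measurable_integral_abs_kernel_sub C').aestronglyMeasurable)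
    (integrable_const _) (fun n => ae_of_all _ ((C n).norm_integral_abs_kernel_sub_le C'))
    (ae_of_all _ inner)
  simpa [D1] using this

/-- For fixed `y`, the copula `C(·, y)` is differentiable at almost every `x` with
derivative `K_C(x, [0,y])`. -/
theorem ae_hasDerivAt (C : Copula) (y : I) : ∀ᵐ x : ℝ, x ∈ Ioo (0 : ℝ) 1 →
    HasDerivAt (fun s => C (projIcc 0 1 zero_le_one s) y)
      ((C.kernel (projIcc 0 1 zero_le_one x)).real (Iic y)) x := by
  set k : ℝ → ℝ := fun s => (C.kernel (projIcc 0 1 zero_le_one s)).real (Iic y) with hk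
  have hkm : Measurable k :=
    (C.measurable_kernel_Iic y).comp continuous_projIcc.measurable
  have hki : IntervalIntegrable k volume 0 1 := by
    rw [intervalIntegrable_iff_integrableOn_Icc_of_le zero_le_one]
    exact Integrable.of_bound hkm.aestronglyMeasurable 1 (ae_of_all _ fun s => by
      rw [Real.norm_of_nonneg (C.kernel_Iic_nonneg _ y)]; exact C.kernel_Iic_le_one _ y)
  have hH : ∀ s ∈ Ioo (0 : ℝ) 1, C (projIcc 0 1 zero_le_one s) y = ∫ t in (0 : ℝ)..s, k t := by
    intro s hs
    have hpre : Iic (projIcc 0 1 zero_le_one s) = (Subtype.val : I → ℝ) ⁻¹' Iic s := by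
      rw [projIcc_of_mem zero_le_one ⟨hs.1.le, hs.2.le⟩]
      ext z
      rfl
    rw [C.eq_setIntegral_kernel, hpre, intervalIntegral.integral_of_le hs.1.le]
    have := measurePreserving_coe.setIntegral_preimage_emb
      (MeasurableEmbedding.subtype_coe measurableSet_Icc) k (Iic s)
    simp only [hk, projIcc_val] at this
    rw [this, Measure.restrict_restrict measurableSet_Iic, 
      show Iic s ∩ Icc 0 1 = Icc 0 s by
        ext z; exact ⟨fun h => ⟨h.2.1, h.1⟩, fun h => ⟨h.2, h.1, h.2.trans hs.2.le⟩⟩,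
      integral_Icc_eq_integral_Ioc]
  filter_upwards [hki.ae_hasDerivAt_integral] with x hx hx01
  rw [uIcc_of_le zero_le_one] at hx
  refine (hx ⟨hx01.1.le, hx01.2.le⟩ 0 (left_mem_Icc.2 zero_le_one)).congr_of_eventuallyEq ?_
  filter_upwards [Ioo_mem_nhds hx01.1 hx01.2] with s hs using hH s hs

/-! ### Extreme Value copulas in exponential coordinates. -/

theorem IsExtremeValueWith.eq_exp {C : Copula} {A : ℝ → ℝ} (h : C.IsExtremeValueWith A)
    {u v : ℝ} (hu : 0 < u) (hv : 0 < v) {x y : I} (hx : (x : ℝ) = Real.exp (-u))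
    (hy : (y : ℝ) = Real.exp (-v)) : C x y = Real.exp (-((u + v) * A (u / (u + v)))) := by
  rw [h.eq_rpow x y (by rw [hx]; exact ⟨Real.exp_pos _, by simpa using hu⟩)
    (by rw [hy]; exact ⟨Real.exp_pos _, by simpa using hv⟩), hx, hy, ← Real.exp_add,
    Real.log_exp, Real.log_exp, ← Real.exp_mul,
    show -u / (-u + -v) = u / (u + v) by rw [← neg_add, neg_div_neg_eq]]
  ring_nf

/-- Taking u = t and v = 1 - t normalises u + v to 1, so A(t) = -log C(e^{-t}, e^{-(1-t)}). -/
theorem tendsto_pickands {C : ℕ → Copula} {C' : Copula} {A : ℕ → ℝ → ℝ} {A' : ℝ → ℝ}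
    (hC : ∀ n, (C n).IsExtremeValueWith (A n)) (hC' : C'.IsExtremeValueWith A')
    (h : ∀ x y : I, Tendsto (fun n => C n x y) atTop (𝓝 (C' x y))) {t : ℝ}
    (ht : t ∈ Icc (0 : ℝ) 1) : Tendsto (fun n => A n t) atTop (𝓝 (A' t)) := by
  rcases ht.1.eq_or_lt with rfl | h0
  · simp [(hC _).isPickands.zero, hC'.isPickands.zero]
  rcases ht.2.eq_or_lt with rfl | h1
  · simp [(hC _).isPickands.one, hC'.isPickands.one]
  let x : I := ⟨Real.exp (-t), (Real.exp_pos _).le, by simpa using h0.le⟩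
  let y : I := ⟨Real.exp (-(1 - t)), (Real.exp_pos _).le, by simpa using h1.le⟩
  have key : ∀ {D : Copula} {B : ℝ → ℝ}, D.IsExtremeValueWith B → B t = -Real.log (D x y) := by
    intro D B hD
    rw [hD.eq_exp h0 (sub_pos.2 h1) (x := x) (y := y) rfl rfl, Real.log_exp, neg_neg]
    simp
  rw [key hC']
  simp_rw [fun n => key (hC n)]
  refine ((h x y).log ?_).neg
  rw [hC'.eq_exp h0 (sub_pos.2 h1) (x := x) (y := y) rfl rfl]
  exact (Real.exp_pos _).ne'

/-- The derivative of the perspective of the Pickands dependence function of an Extreme Value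
copula in terms of the Markov kernel. -/
theorem IsExtremeValueWith.hasDerivAt_perspective {C : Copula} {A : ℝ → ℝ}
    (h : C.IsExtremeValueWith A) {u v : ℝ} (hu : 0 < u) (hv : 0 < v) {x y : I}
    (hx : (x : ℝ) = Real.exp (-u)) (hy : (y : ℝ) = Real.exp (-v))
    (hd : HasDerivAt (fun s => C (projIcc 0 1 zero_le_one s) y) ((C.kernel x).real (Iic y)) x) :
    HasDerivAt (fun u => (u + v) * A (u / (u + v)))
      ((C.kernel x).real (Iic y) * x / C x y) u := by
  have hpos : C x y ≠ 0 := by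
    rw [h.eq_exp hu hv hx hy]
    exact (Real.exp_pos _).ne'
  have hexp : HasDerivAt (fun u : ℝ => Real.exp (-u)) (-x) u := by
    have := (hasDerivAt_neg u).exp
    rwa [mul_neg_one, ← hx] at this
  rw [hx] at hd
  have hcomp := hd.comp u hexp
  have hval : projIcc (0 : ℝ) 1 zero_le_one (Real.exp (-u)) = x := by
    rw [← hx, projIcc_val]
  have hlog := (hcomp.log (by simpa [hval] using hpos)).neg
  have hd' := hlog.congr_of_eventuallyEq (f₁ := fun u => (u + v) * A (u / (u + v))) ?_
  · have heq : -((C.kernel x).real (Iic y) * -x / C (projIcc 0 1 zero_le_one (Real.exp (-u))) y)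
        = (C.kernel x).real (Iic y) * x / C x y := by rw [hval]; ring
    exact heq ▸ hd'
  · filter_upwards [Ioi_mem_nhds hu] with s hs
    have hs' : Real.exp (-s) ≤ 1 := by simpa using (le_of_lt hs)
    have := h.eq_exp hs hv (x := projIcc 0 1 zero_le_one (Real.exp (-s))) (y := y)
      (by rw [projIcc_of_mem zero_le_one ⟨(Real.exp_pos _).le, hs'⟩]) hy
    simp [this]

/-- For almost every x the limit and all countably many C_n are differentiable at x for this y. The
derivatives of the convex perspectives are then subgradients and converge. -/
theorem ae_tendsto_kernel_Iic {C : ℕ → Copula} {C' : Copula} {A : ℕ → ℝ → ℝ} {A' : ℝ → ℝ}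
    (hC : ∀ n, (C n).IsExtremeValueWith (A n)) (hC' : C'.IsExtremeValueWith A')
    (h : ∀ x ∈ Icc (0 : ℝ) 1, Tendsto (fun n => A n x) atTop (𝓝 (A' x))) {y : I}
    (hy : (y : ℝ) ∈ Ioo (0 : ℝ) 1) : ∀ᵐ x : I,
      Tendsto (fun n => ((C n).kernel x).real (Iic y)) atTop (𝓝 ((C'.kernel x).real (Iic y))) := by
  have toI : ∀ D : Copula, ∀ᵐ x : I, (x : ℝ) ∈ Ioo (0 : ℝ) 1 →
      HasDerivAt (fun s => D (projIcc 0 1 zero_le_one s) y) ((D.kernel x).real (Iic y)) x := by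
    intro D
    have := measurePreserving_coe.quasiMeasurePreserving.ae
      (ae_restrict_of_ae (s := Icc (0 : ℝ) 1) (D.ae_hasDerivAt y))
    filter_upwards [this] with x hx hx01
    simpa only [projIcc_val] using hx hx01
  have hne : ∀ z : I, ∀ᵐ x : I, x ≠ z := fun z => by simp [ae_iff]
  filter_upwards [toI C', ae_all_iff.2 fun n => toI (C n), hne 0, hne 1] with x hx' hx hx0 hx1
  have hx01 : (x : ℝ) ∈ Ioo (0 : ℝ) 1 :=
    ⟨unitInterval.pos_iff_ne_zero.2 hx0, unitInterval.lt_one_iff_ne_one.2 hx1⟩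
  have hu : 0 < -Real.log x := neg_pos.2 (Real.log_neg hx01.1 hx01.2)
  have hv : 0 < -Real.log y := neg_pos.2 (Real.log_neg hy.1 hy.2)
  have ex : (x : ℝ) = Real.exp (- -Real.log x) := by rw [neg_neg, Real.exp_log hx01.1]
  have ey : (y : ℝ) = Real.exp (- -Real.log y) := by rw [neg_neg, Real.exp_log hy.1]
  have hpersp : ∀ u ∈ Ioi (0 : ℝ), Tendsto
      (fun n => (u + -Real.log y) * A n (u / (u + -Real.log y))) atTop
      (𝓝 ((u + -Real.log y) * A' (u / (u + -Real.log y)))) := fun u hu =>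
    (h _ ⟨div_nonneg (le_of_lt hu) (add_pos hu hv).le,
      (div_le_one (add_pos hu hv)).2 (le_add_of_nonneg_right hv.le)⟩).const_mul _
  have hder := hC'.hasDerivAt_perspective hu hv ex ey (hx' hx01)
  have hdern := fun n => (hC n).hasDerivAt_perspective hu hv ex ey (hx n hx01)
  have hquot := hder.tendsto_of_slope (Ioi_mem_nhds hu) hpersp
    (fun n z hz huz =>
      ((hC n).isPickands.convexOn_perspective hv).le_slope_of_hasDerivAt hu hz huz (hdern n))
    (fun n z hz hzu =>
      ((hC n).isPickands.convexOn_perspective hv).slope_le_of_hasDerivAt hz hu hzu (hdern n))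
  have hval : Tendsto (fun n => C n x y) atTop (𝓝 (C' x y)) := by
    rw [hC'.eq_exp hu hv ex ey]
    simp_rw [fun n => (hC n).eq_exp hu hv ex ey]
    exact (hpersp _ hu).neg.rexp
  have hpos : ∀ {D : Copula} {B : ℝ → ℝ}, D.IsExtremeValueWith B → D x y ≠ 0 := by
    intro D B hD
    rw [hD.eq_exp hu hv ex ey]
    exact (Real.exp_pos _).ne'
  -- Recovers the kernel from P' = K x / C, using convergence of the copula values.
  have := (hquot.mul hval).div_const (x : ℝ)
  simp_rw [div_mul_cancel₀ _ (hpos hC'), fun n => div_mul_cancel₀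
    (((C n).kernel x).real (Iic y) * x) (hpos (hC n)), mul_div_cancel_right₀ _ hx01.1.ne'] at this
  exact this

/-- Rational y suffice, so countably many null sets are discarded. Logarithmic coordinates cover
only 0 < q < 1: for q ≥ 1 the set is everything, and for q ≤ 0 it lies in {0}, which is almost
surely not charged. -/
theorem weakCondTendsto_of_tendsto_pickands {C : ℕ → Copula} {C' : Copula} {A : ℕ → ℝ → ℝ}
    {A' : ℝ → ℝ} (hC : ∀ n, (C n).IsExtremeValueWith (A n)) (hC' : C'.IsExtremeValueWith A')
    (h : ∀ x ∈ Icc (0 : ℝ) 1, Tendsto (fun n => A n x) atTop (𝓝 (A' x))) :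
    WeakCondTendsto C C' := by
  have key : ∀ q : ℚ, ∀ᵐ x : I,
      Tendsto (fun n => ((C n).kernel x).real {z : I | (z : ℝ) ≤ q}) atTop
        (𝓝 ((C'.kernel x).real {z : I | (z : ℝ) ≤ q})) := by
    intro q
    rcases lt_or_ge 0 (q : ℝ) with h0 | h0
    · rcases lt_or_ge (q : ℝ) 1 with h1 | h1
      · exact ae_tendsto_kernel_Iic hC hC' h (y := ⟨q, h0.le, h1.le⟩) ⟨h0, h1⟩
      · have : {z : I | (z : ℝ) ≤ q} = univ := eq_univ_of_forall fun z => z.2.2.trans h1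
        simp [this]
    · have hsub : {z : I | (z : ℝ) ≤ q} ⊆ {0} := fun z hz =>
        Subtype.ext (le_antisymm (le_trans hz h0) z.2.1)
      have hnull : ∀ {D : Copula} {x : I}, D.kernel x {0} = 0 →
          (D.kernel x).real {z : I | (z : ℝ) ≤ q} = 0 := fun hD => by
        rw [Measure.real, measure_mono_null hsub hD, ENNReal.toReal_zero]
      filter_upwards [C'.ae_kernel_singleton 0, ae_all_iff.2 fun n => (C n).ae_kernel_singleton 0]
        with x hx' hx
      simp [hnull hx', hnull (hx _)]
  filter_upwards [ae_all_iff.2 key] with x hx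
  exact ProbabilityMeasure.tendsto_of_tendsto_cdf_rat hx

end Copula

theorem mainTheorem2 (C : ℕ → Copula) (C' : Copula) (A : ℕ → ℝ → ℝ) (A' : ℝ → ℝ)
    (hC : ∀ n, (C n).IsExtremeValueWith (A n)) (hC' : C'.IsExtremeValueWith A') :
    List.TFAE [
      ∀ x y : I, Tendsto (fun n => C n x y) atTop (𝓝 (C' x y)),
      ∀ x ∈ Icc (0 : ℝ) 1, Tendsto (fun n => A n x) atTop (𝓝 (A' x)),
      ∀ x ∈ contRightDeriv A',
        Tendsto (fun n => rightDeriv (A n) x) atTop (𝓝 (rightDeriv A' x)),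
      Tendsto (fun n => Copula.D1 (C n) C') atTop (𝓝 0),
      Copula.WeakCondTendsto C C'] := by
  tfae_have 1 → 2 := fun h _ ht => Copula.tendsto_pickands hC hC' h ht
  tfae_have 2 → 3 := fun h _ hx =>
    IsPickands.tendsto_rightDeriv (fun n => (hC n).isPickands) hC'.isPickands h hx
  tfae_have 3 → 2 := fun h _ hx =>
    IsPickands.tendsto_of_tendsto_rightDeriv (fun n => (hC n).isPickands) hC'.isPickands h hx
  tfae_have 2 → 5 := Copula.weakCondTendsto_of_tendsto_pickands hC hC'
  tfae_have 5 → 4 := Copula.WeakCondTendsto.tendsto_D1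
  tfae_have 4 → 1 := Copula.tendsto_of_tendsto_D1
  tfae_finish
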